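/- Let $L/K$ be a finite Galois extension of number fields with group $G=\mathrm{Gal}(L/K)$, let $E$ be an intermediate field, and let $H=\mathrm{Gal}(L/E)\subseteq G$. For a number field $F$ write $\Sigma_F$ for the set of its finite primes. For $F\in\{E,K\}$, a finite set $S_F\subset\Sigma_F$ outside which $L/F$ is unramified, and a real-valued class function $\varphi$ on $\mathrm{Gal}(L/F)$, the frobenian function for $F$ attached to $\varphi$ is the function $\psi:\Sigma_F\setminus S_F\to\mathbb R$ with $\psi(\mathfrak p)=\varphi(\sigma)$ for every $\mathfrak p\in\Sigma_F\setminus S_F$ and every Frobenius element $\sigma\in\mathrm{Gal}(L/F)$ of a prime of $L$ above $\mathfrak p$. Put $$A_F[\psi](x)=\frac{\sum_{\mathfrak p\in\Sigma_F\setminus S_F,\ \mathcal N\mathfrak p\le x}\psi(\mathfrak p)}{\int_2^x(\log t)^{-1}\,dt},\qquad \mathbb E_F[\psi]=\lim_{x\to\infty}A_F[\psi](x).$$ Let $S\subset\Sigma_K$ and $T\subset\Sigma_E$ be finite sets such that $L/K$ is unramified outside $S$ and $L/E$ is unramified outside $T$. Let $\varphi$ be a real-valued class function on $H$, let $\psi:\Sigma_E\setminus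 T\to\mathbb R$ be the frobenian function for $E$ attached to $\varphi$, and let $\psi':\Sigma_K\setminus S\to\mathbb R$ be the frobenian function for $K$ attached to the induced class function $$(\mathrm{Ind}_H^G\varphi)(g)=\sum_{i}\varphi(g_i^{-1}gg_i),$$ where $g_i$ runs over representatives of $G/H$ and $\varphi$ is extended by zero to $G$. Then $$\mathbb E_E[\psi]=\mathbb E_K[\psi'],$$ in the sense that for every real $\ell$ the limit $\mathbb E_E[\psi]$ exists and equals $\ell$ if and only if the limit $\mathbb E_K[\psi']$ exists and equals $\ell$; moreover, unconditionally, $A_E[\psi](x)-A_K[\psi'](x)\to 0$ as $x\to\infty$. -/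

import Mathlib

open NumberField IsDedekindDomain Filter Topology

/-- A class function on a group: a function that is constant on conjugacy classes. -/
def IsClassFunction {G Ω : Type*} [Group G] (φ : G → Ω) : Prop :=
  ∀ g h : G, φ (h * g * h⁻¹) = φ g

open Classical in
/-- Extension by zero to `G` of a real function on a subgroup `H`. -/
noncomputable def extendByZero {G : Type*} [Group G] (H : Subgroup G) (φ : H → ℝ) (g : G) : ℝ :=
  if hg : g ∈ H then φ ⟨g, hg⟩ else 0

/-- The induction to `G` of a class function `φ` on a subgroup `H` of finite index:
`g ↦ ∑ φ (gᵢ⁻¹ g gᵢ)`, the sum over representatives `gᵢ` of `G / H`, where `φ` is extended by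
zero. The choice of the representatives is immaterial, see `inducedClassFunction_eq`. -/
noncomputable def inducedClassFunction {G : Type*} [Group G] (H : Subgroup G) [Fintype (G ⧸ H)]
    (φ : H → ℝ) (g : G) : ℝ :=
  ∑ q : G ⧸ H, extendByZero H φ (q.out⁻¹ * g * q.out)

theorem extendByZero_conj {G : Type*} [Group G] (H : Subgroup G) {φ : H → ℝ}
    (hφ : IsClassFunction φ) (g : G) (h : H) :
    extendByZero H φ ((h : G)⁻¹ * g * h) = extendByZero H φ g := by
  by_cases hg : g ∈ H
  · have h1 : (h : G)⁻¹ * g * h ∈ H := H.mul_mem (H.mul_mem (H.inv_mem h.2) hg) h.2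
    have h2 := hφ ⟨g, hg⟩ h⁻¹
    simp only [extendByZero, dif_pos hg, dif_pos h1]
    rw [← h2]
    congr 1
    ext
    simp
  · have h1 : (h : G)⁻¹ * g * h ∉ H := fun h1 => hg <| by
      have := H.mul_mem (H.mul_mem h.2 h1) (H.inv_mem h.2)
      simpa [mul_assoc] using this
    simp only [extendByZero, dif_neg hg, dif_neg h1]

theorem inducedClassFunction_eq {G : Type*} [Group G] (H : Subgroup G) [Fintype (G ⧸ H)]
    {φ : H → ℝ} (hφ : IsClassFunction φ) (s : G ⧸ H → G) (hs : ∀ q, (s q : G ⧸ H) = q) (g : G) :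
    inducedClassFunction H φ g = ∑ q : G ⧸ H, extendByZero H φ ((s q)⁻¹ * g * s q) := by
  refine Finset.sum_congr rfl fun q _ => ?_
  have h1 : (s q)⁻¹ * q.out ∈ H := by
    rw [← QuotientGroup.eq, hs q, QuotientGroup.out_eq']
  rw [← extendByZero_conj H hφ ((s q)⁻¹ * g * s q) ⟨_, h1⟩]
  congr 1
  simp [mul_assoc]

theorem isClassFunction_inducedClassFunction {G : Type*} [Group G] (H : Subgroup G)
    [Fintype (G ⧸ H)] {φ : H → ℝ} (hφ : IsClassFunction φ) :
    IsClassFunction (inducedClassFunction H φ) := by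
  intro g h
  rw [inducedClassFunction_eq H hφ (fun q => h * (h⁻¹ • q).out)
    (fun q => by
      simp [← smul_eq_mul, ← MulAction.Quotient.smul_mk])]
  unfold inducedClassFunction
  refine Fintype.sum_equiv (MulAction.toPerm h⁻¹) _ _ fun q => ?_
  congr 1
  simp [mul_assoc]

/-- The Galois extension `L / K` of number fields is unramified outside the set `S` of finite
primes of `K`. -/
def UnramifiedOutside (K L : Type*) [Field K] [Field L] [Algebra K L]
    (S : Set (HeightOneSpectrum (𝓞 K))) : Prop :=
  ∀ v ∉ S, ∀ (Q : Ideal (𝓞 L)) [Q.IsPrime] [Q.LiesOver v.asIdeal],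
    Algebra.IsUnramifiedAt (𝓞 K) Q

instance smulCommClass_gal_ringOfIntegers (K L : Type*) [Field K] [Field L] [Algebra K L] :
    SMulCommClass Gal(L/K) (𝓞 K) (𝓞 L) where
  smul_comm σ a x := by
    have h : σ • algebraMap (𝓞 K) (𝓞 L) a = algebraMap (𝓞 K) (𝓞 L) a :=
      RingOfIntegers.ext (σ.commutes (a : K))
    rw [Algebra.smul_def, Algebra.smul_def, smul_mul', h]

/-- `ψ : Σ_K ∖ S → Ω` is the frobenian function attached to the function `φ` on `Gal(L/K)`:
`S` is finite, `L / K` is unramified outside `S`, `φ` is a class function, and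
`ψ v = φ σ` for every `v ∉ S` and every Frobenius element `σ` of a prime `Q` of `L` over `v`. -/
structure IsFrobenianWith (K L : Type*) {Ω : Type*} [Field K] [Field L] [Algebra K L]
    (S : Set (HeightOneSpectrum (𝓞 K))) (φ : Gal(L/K) → Ω) (ψ : {v // v ∉ S} → Ω) : Prop where
  finite : S.Finite
  unramified : UnramifiedOutside K L S
  isClassFunction : IsClassFunction φ
  eq_frob : ∀ (v : {v // v ∉ S}) (Q : Ideal (𝓞 L)) [Q.IsPrime] [Q.LiesOver v.1.asIdeal]
    (σ : Gal(L/K)), IsArithFrobAt (𝓞 K) σ Q → ψ v = φ σ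

theorem finite_primes_norm_le (K : Type*) [Field K] [NumberField K]
    (S : Set (HeightOneSpectrum (𝓞 K))) (x : ℝ) :
    {v : {v // v ∉ S} | (Ideal.absNorm v.1.asIdeal : ℝ) ≤ x}.Finite := by
  have h := Ideal.finite_setOfPred_absNorm_le (S := 𝓞 K) ⌊x⌋₊
  refine Set.Finite.of_finite_image (f := fun v => v.1.asIdeal) (h.subset ?_) ?_
  · rintro _ ⟨v, hv, rfl⟩
    exact Nat.le_floor hv
  · intro v _ w _ hvw
    exact Subtype.ext (HeightOneSpectrum.ext hvw)

/-- `∑ ψ(v)` over the primes `v ∉ S` of `K` with norm at most `x`. -/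
noncomputable def primeSum (K : Type*) [Field K] [NumberField K]
    (S : Set (HeightOneSpectrum (𝓞 K))) (ψ : {v // v ∉ S} → ℝ) (x : ℝ) : ℝ :=
  ∑ v ∈ (finite_primes_norm_le K S x).toFinset, ψ v

/-- The logarithmic integral `∫₂ˣ dt / log t`. -/
noncomputable def logIntegral (x : ℝ) : ℝ := ∫ t in (2 : ℝ)..x, (Real.log t)⁻¹

/-- `𝔼_K[ψ] = ℓ`: the limit of `(∑_{N v ≤ x} ψ(v)) / Li(x)` as `x → ∞` exists and equals `ℓ`. -/
def HasPrimeMean (K : Type*) [Field K] [NumberField K]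
    (S : Set (HeightOneSpectrum (𝓞 K))) (ψ : {v // v ∉ S} → ℝ) (ℓ : ℝ) : Prop :=
  Tendsto (fun x : ℝ => primeSum K S ψ x / logIntegral x) atTop (𝓝 ℓ)

/-- `Ind_H^G φ` for a function `φ` on `H = Gal(L/E)` and `G = Gal(L/K)`, where `H` is identified
with the subgroup of `G` fixing `E`. -/
noncomputable def galoisInduced {K L : Type*} [Field K] [Field L] [Algebra K L]
    [FiniteDimensional K L] (E : IntermediateField K L) (φ : Gal(L/E) → ℝ) : Gal(L/K) → ℝ :=
  letI : Fintype (Gal(L/K) ⧸ E.fixingSubgroup) := Fintype.ofFinite _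
  inducedClassFunction E.fixingSubgroup (fun h => φ (E.fixingSubgroupEquiv h))

/-! Take a prime `v` of `K` outside a finite set, a prime `Q` of `L` above it, and its Frobenius
`σ`. The map `gH ↦ g⁻¹Q ∩ E` is a bijection from the cosets with `g⁻¹σg ∈ H` onto the primes `w` of
`E` above `v` with the same norm as `v`, and for such a coset `g⁻¹σg` is also Frobenius at `g⁻¹Q`
over `E`. Hence `ψ' v` is the sum of `ψ w` over these `w` (`sum_frobenian_eq_frobenian_induced`).
Summed over norms up to `x`, the two prime sums differ only by a bounded contribution of exceptional
primes and by the primes `w` whose norm exceeds that of the prime below. The latter have norm `p ^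
n` with `n ≥ 2`, so there are `O(√x)` of them (`card_primes_norm_le_not_prime`). Since `ψ` is
bounded and `√x` is negligible against the logarithmic integral, the averages differ by `o(1)`. No
density theorem is needed. -/

section

open scoped Pointwise

/-! ### Frobenius elements at unramified primes -/

theorem IsArithFrobAt.eq_of_isUnramifiedAt {R S G : Type*} [CommRing R] [CommRing S] [Algebra R S]
    [IsDomain S] [IsNoetherianRing S] [Group G] [MulSemiringAction G S] [SMulCommClass G R S]
    [FaithfulSMul G S] {Q : Ideal S} [Q.IsPrime] [Algebra.IsUnramifiedAt R Q] {σ τ : G}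
    (hσ : IsArithFrobAt R σ Q) (hτ : IsArithFrobAt R τ Q) : σ = τ := by
  have h := AlgHom.IsArithFrobAt.eq_of_isUnramifiedAt hσ hτ Q.primeCompl_le_nonZeroDivisors
  exact FaithfulSMul.eq_of_smul_eq_smul fun x : S => DFunLike.congr_fun h x

theorem IsArithFrobAt.pow_smul_sub_mem {R S G : Type*} [CommRing R] [CommRing S] [Algebra R S]
    [Group G] [MulSemiringAction G S] [SMulCommClass G R S] {Q : Ideal S} {σ : G}
    (hσ : IsArithFrobAt R σ Q) (n : ℕ) (x : S) :
    σ ^ n • x - x ^ Nat.card (R ⧸ Q.under R) ^ n ∈ Q := by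
  induction n generalizing x with
  | zero => simp
  | succ n ih =>
    have h1 := ih (σ • x)
    have h2 : σ • x - x ^ Nat.card (R ⧸ Q.under R) ∈ Q := hσ x
    rw [← Ideal.Quotient.eq] at h1 h2 ⊢
    rw [pow_succ, mul_smul, h1, map_pow, h2, map_pow, map_pow, ← pow_mul, pow_succ']

attribute [local instance] Ideal.Quotient.field in
-- Endomorphisms of the residue extension are powers of its Frobenius, so `τ` agrees with some `σ ^
-- n` modulo `Q`; uniqueness of the Frobenius lifts this to an equality.
theorem IsArithFrobAt.exists_pow_eq_of_isUnramifiedAt {R S G : Type*} [CommRing R] [CommRing S]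
    [Algebra R S] [IsDomain S] [IsNoetherianRing S] [Group G] [MulSemiringAction G S]
    [SMulCommClass G R S] [FaithfulSMul G S] {Q : Ideal S} [Q.IsPrime] [Finite (S ⧸ Q)]
    [Algebra.IsUnramifiedAt R Q] {σ τ : G} (hσ : IsArithFrobAt R σ Q)
    (hτ : τ ∈ MulAction.stabilizer G Q) : ∃ n : ℕ, σ ^ n = τ := by
  have : Q.IsMaximal := Ideal.Quotient.maximal_of_isField _ (Finite.isField_of_domain (S ⧸ Q))
  have : Finite (R ⧸ Q.under R) := .of_injective _ Ideal.algebraMap_quotient_injective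
  have : (Q.under R).IsMaximal :=
    Ideal.Quotient.maximal_of_isField _ (Finite.isField_of_domain (R ⧸ Q.under R))
  cases nonempty_fintype (R ⧸ Q.under R)
  obtain ⟨n, hn⟩ := (FiniteField.bijective_frobeniusAlgHom_pow (R ⧸ Q.under R) (S ⧸ Q)).2
    (Ideal.Quotient.stabilizerHom Q (Q.under R) G ⟨τ, hτ⟩).toAlgHom
  refine ⟨n, ?_⟩
  have h1 (x : S) : τ • x - σ ^ (n : ℕ) • x ∈ Q := by
    have h2 := DFunLike.congr_fun hn (Ideal.Quotient.mk Q x)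
    have h3 := hσ.pow_smul_sub_mem n x
    rw [← Ideal.Quotient.eq] at h3 ⊢
    rw [h3]
    simp only [AlgHom.coe_pow, FiniteField.coe_frobeniusAlgHom, pow_iterate] at h2
    rw [map_pow, ← Fintype.card_eq_nat_card]
    exact h2.symm
  -- `τ * (σ ^ n)⁻¹` is trivial modulo `Q`, so multiplying `σ` by it gives another Frobenius. This
  -- takes the place of an argument with the inertia group.
  have h2 : IsArithFrobAt R (τ * (σ ^ (n : ℕ))⁻¹ * σ) Q := by
    intro x
    have h3 := h1 ((σ ^ (n : ℕ))⁻¹ • σ • x)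
    rw [smul_inv_smul, smul_smul, smul_smul] at h3
    have h4 : σ • x - x ^ Nat.card (R ⧸ Q.under R) ∈ Q := hσ x
    have := Q.add_mem h3 h4
    rwa [sub_add_sub_cancel] at this
  have h3 := h2.eq_of_isUnramifiedAt hσ
  rw [mul_eq_right, mul_inv_eq_one] at h3
  exact h3.symm

end

/-! ### Counting primes whose norm is not prime -/

theorem card_primes_containing_le_finrank (F : Type*) [Field F] [NumberField F] {p : ℕ}
    (hp : p.Prime) (W : Finset (HeightOneSpectrum (𝓞 F)))
    (hW : ∀ w ∈ W, (p : 𝓞 F) ∈ w.asIdeal) : W.card ≤ Module.finrank ℚ F := by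
  have hp0 : Ideal.span {(p : ℤ)} ≠ ⊥ := by simpa using hp.ne_zero
  have hprime : (Ideal.span {(p : ℤ)}).IsPrime := by
    rw [Ideal.span_singleton_prime (by exact_mod_cast hp.ne_zero)]
    exact Nat.prime_iff_prime_int.mp hp
  have hmax : (Ideal.span {(p : ℤ)}).IsMaximal := hprime.isMaximal hp0
  have hover : ∀ w ∈ W, w.asIdeal ∈ (Ideal.span {(p : ℤ)}).primesOver (𝓞 F) := fun w hw =>
    ⟨w.isPrime, ⟨hmax.eq_of_le (Ideal.IsPrime.under ℤ _).ne_top (by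
      rw [Ideal.span_singleton_le_iff_mem, Ideal.mem_under]
      simpa using hW w hw)⟩⟩
  have hcard : W.card ≤ Fintype.card ((Ideal.span {(p : ℤ)}).primesOver (𝓞 F)) := by
    rw [← Fintype.card_coe]
    refine Fintype.card_le_of_injective (fun w : W => ⟨w.1.asIdeal, hover w.1 w.2⟩) fun w w' h => ?_
    exact Subtype.ext (HeightOneSpectrum.ext (congrArg Subtype.val h))
  refine hcard.trans ?_
  rw [← RingOfIntegers.rank, ← Ideal.sum_ramification_inertia_eq_finrank (Ideal.span {(p : ℤ)}),
    ← Finset.card_univ, Finset.card_eq_sum_ones]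
  exact Finset.sum_le_sum fun P _ =>
    Nat.mul_pos (P.1.ramificationIdx_pos ℤ) (P.1.inertiaDeg_pos ℤ)

/-- Such a norm is `p ^ n` with `n ≥ 2`, so `p ≤ √x`, and each `p` lies in at most `[F : ℚ]` primes.
-/
theorem card_primes_norm_le_not_prime (F : Type*) [Field F] [NumberField F] {x : ℝ}
    (W : Finset (HeightOneSpectrum (𝓞 F)))
    (hW : ∀ w ∈ W, (Ideal.absNorm w.asIdeal : ℝ) ≤ x ∧ ¬ (Ideal.absNorm w.asIdeal).Prime) :
    (W.card : ℝ) ≤ Module.finrank ℚ F * (√x + 1) := by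
  classical
  have h (w : HeightOneSpectrum (𝓞 F)) := w.asIdeal.exists_prime_and_absNorm_eq_pow
  choose p n hn hmem hp hpn using h
  have h1 : W.card ≤ Module.finrank ℚ F * (W.image p).card := by
    refine Finset.card_le_mul_card_image W _ fun q hq => ?_
    obtain ⟨w, -, rfl⟩ := Finset.mem_image.mp hq
    refine card_primes_containing_le_finrank F (hp w) _ fun w' hw' => ?_
    rw [← (Finset.mem_filter.mp hw').2]
    exact hmem w'
  have h2 : W.image p ⊆ Finset.range (⌊√x⌋₊ + 1) := by
    intro q hq
    obtain ⟨w, hw, rfl⟩ := Finset.mem_image.mp hq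
    obtain ⟨hx, hnp⟩ := hW w hw
    rw [hpn w] at hx hnp
    have hn2 : 2 ≤ n w := by
      by_contra hlt
      have : n w = 1 := by have := hn w; omega
      rw [this, pow_one] at hnp
      exact hnp (hp w)
    rw [Finset.mem_range, Nat.lt_succ_iff]
    refine Nat.le_floor (Real.le_sqrt_of_sq_le (le_trans ?_ hx))
    exact_mod_cast Nat.pow_le_pow_right (hp w).pos hn2
  have h3 := Finset.card_le_card h2
  rw [Finset.card_range] at h3
  calc (W.card : ℝ) ≤ Module.finrank ℚ F * ((⌊√x⌋₊ : ℝ) + 1) := by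
        exact_mod_cast h1.trans (Nat.mul_le_mul_left _ h3)
    _ ≤ _ := by gcongr; exact Nat.floor_le (Real.sqrt_nonneg x)

/-! ### Growth of the logarithmic integral -/

theorem sub_two_div_log_le_logIntegral {x : ℝ} (hx : 2 ≤ x) :
    (x - 2) / Real.log x ≤ logIntegral x := by
  have h : ∫ _ in (2 : ℝ)..x, (Real.log x)⁻¹ ≤ logIntegral x := by
    refine intervalIntegral.integral_mono_on hx (by simp) ?_ fun t ht => ?_
    · refine ContinuousOn.intervalIntegrable ?_
      rw [Set.uIcc_of_le hx]
      refine ContinuousOn.inv₀ (Real.continuousOn_log.mono fun t ht => ?_) fun t ht => ?_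
      · exact (lt_of_lt_of_le two_pos ht.1).ne'
      · exact (Real.log_pos (lt_of_lt_of_le one_lt_two ht.1)).ne'
    · have := Real.log_pos (lt_of_lt_of_le one_lt_two ht.1)
      exact inv_anti₀ this (Real.log_le_log (by linarith [ht.1]) ht.2)
  simpa [div_eq_mul_inv] using h

theorem tendsto_sqrt_add_one_div_logIntegral :
    Tendsto (fun x : ℝ => (√x + 1) / logIntegral x) atTop (𝓝 0) := by
  -- For `x ≥ 4` one has `(√x + 1) * √x ≤ 4 * (x - 2)`, which is where the factor 4 comes from.
  have h : Tendsto (fun x : ℝ => 4 * (Real.log x / x ^ (1 / 2 : ℝ))) atTop (𝓝 0) := by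
    simpa using ((isLittleO_log_rpow_atTop (by norm_num : (0 : ℝ) < 1 / 2)).tendsto_div_nhds_zero
      ).const_mul 4
  refine squeeze_zero' ?_ ?_ h
  all_goals
    filter_upwards [eventually_ge_atTop 4] with x hx
    have hlog : 0 < Real.log x := Real.log_pos (by linarith)
    have hle := sub_two_div_log_le_logIntegral (by linarith : 2 ≤ x)
    have hpos : 0 < (x - 2) / Real.log x := div_pos (by linarith) hlog
  · have := hpos.trans_le hle
    positivity
  · rw [← Real.sqrt_eq_rpow]
    have hs : 0 < √x := Real.sqrt_pos.mpr (by linarith)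
    have hs2 : √x * √x = x := Real.mul_self_sqrt (by linarith)
    refine (div_le_div_of_nonneg_left (by positivity) hpos hle).trans ?_
    rw [div_div_eq_mul_div, ← mul_div_assoc, div_le_div_iff₀ (by linarith) hs]
    have h1 : (√x + 1) * √x ≤ 4 * (x - 2) := by nlinarith [sq_nonneg (√x - 2)]
    nlinarith

theorem tendsto_div_logIntegral_of_abs_le {f : ℝ → ℝ} {C : ℝ}
    (hf : ∀ x, |f x| ≤ C * (√x + 1)) :
    Tendsto (fun x => f x / logIntegral x) atTop (𝓝 0) := by
  have h := (tendsto_sqrt_add_one_div_logIntegral.abs.const_mul C)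
  rw [abs_zero, mul_zero] at h
  refine squeeze_zero_norm (fun x => ?_) h
  rw [Real.norm_eq_abs, abs_div, abs_div, abs_of_nonneg (by positivity : 0 ≤ √x + 1), ← mul_div_assoc]
  gcongr
  exact hf x

/-! ### Primes of degree one and the induced class function -/

section

open scoped Pointwise

theorem natCard_quotient_eq_absNorm {R : Type*} [CommRing R] [IsDedekindDomain R]
    [Module.Free ℤ R] (I : Ideal R) : Nat.card (R ⧸ I) = Ideal.absNorm I := by
  simp [Ideal.absNorm_apply, Submodule.cardQuot_apply]

section

variable {K L : Type*} [Field K] [Field L] [Algebra K L] (E : IntermediateField K L)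

theorem fixingSubgroupEquiv_smul_ringOfIntegers (h : E.fixingSubgroup) (x : 𝓞 L) :
    E.fixingSubgroupEquiv h • x = (h : Gal(L/K)) • x := rfl

theorem fixingSubgroupEquiv_smul_ideal (h : E.fixingSubgroup) (Q : Ideal (𝓞 L)) :
    E.fixingSubgroupEquiv h • Q = (h : Gal(L/K)) • Q := by
  ext x
  rw [Ideal.mem_pointwise_smul_iff_inv_smul_mem, Ideal.mem_pointwise_smul_iff_inv_smul_mem,
    ← map_inv, fixingSubgroupEquiv_smul_ringOfIntegers]
  rfl

variable [NumberField K] [NumberField L]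

/-- If a Frobenius element at `Q` over `K` fixes `E`, then `Q ∩ E` has degree one over `K`. -/
theorem absNorm_under_eq_of_isArithFrobAt (Q : Ideal (𝓞 L)) [Q.IsPrime] (hQ : Q ≠ ⊥)
    {h : Gal(L/K)} (hh : h ∈ E.fixingSubgroup) (hF : IsArithFrobAt (𝓞 K) h Q) :
    Ideal.absNorm (Q.under (𝓞 E)) = Ideal.absNorm (Q.under (𝓞 K)) := by
  have hne : Q.under (𝓞 E) ≠ ⊥ := mt Ideal.eq_bot_of_comap_eq_bot hQ
  have hneK : Q.under (𝓞 K) ≠ ⊥ := mt Ideal.eq_bot_of_comap_eq_bot hQ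
  have hmax : (Q.under (𝓞 E)).IsMaximal := Ideal.IsPrime.isMaximal inferInstance hne
  have hmaxK : (Q.under (𝓞 K)).IsMaximal := Ideal.IsPrime.isMaximal inferInstance hneK
  have hpow := Ideal.absNorm_eq_pow_inertiaDeg'_of_liesOver (Q.under (𝓞 E)) (Q.under (𝓞 K))
    inferInstance hneK
  have hfin := Ideal.finiteQuotientOfFreeOfNeBot _ hne
  have hfinK := Ideal.finiteQuotientOfFreeOfNeBot _ hneK
  let := Ideal.Quotient.field (Q.under (𝓞 E))
  have := Fintype.ofFinite (𝓞 E ⧸ Q.under (𝓞 E))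
  set q := Ideal.absNorm (Q.under (𝓞 K)) with hq
  have hq1 : 1 < q := by
    rw [hq, ← natCard_quotient_eq_absNorm]
    exact Finite.one_lt_card
  -- `h` fixes `E` and acts as the `q`-th power modulo `Q`, so every residue class is a root of `X ^
  -- q - X`, which has at most `q` roots.
  have hroot (y : 𝓞 E ⧸ Q.under (𝓞 E)) : y ^ q = y := by
    obtain ⟨x, rfl⟩ := Ideal.Quotient.mk_surjective y
    rw [← map_pow, Ideal.Quotient.eq, Ideal.mem_under, map_sub, map_pow]
    have h1 : h • algebraMap (𝓞 E) (𝓞 L) x - algebraMap (𝓞 E) (𝓞 L) x ^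
      Nat.card (𝓞 K ⧸ Q.under (𝓞 K)) ∈ Q := hF _
    have h2 : h • algebraMap (𝓞 E) (𝓞 L) x = algebraMap (𝓞 E) (𝓞 L) x :=
      RingOfIntegers.ext (hh (x : E))
    rw [h2, natCard_quotient_eq_absNorm, ← neg_mem_iff, neg_sub] at h1
    exact h1
  have hle : Ideal.absNorm (Q.under (𝓞 E)) ≤ q := by
    classical
    rw [← natCard_quotient_eq_absNorm, ← Fintype.card_eq_nat_card, ← Finset.card_univ]
    have hX := FiniteField.X_pow_card_sub_X_ne_zero (𝓞 E ⧸ Q.under (𝓞 E)) hq1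
    refine (Finset.card_le_card (fun y _ => ?_)).trans
      ((Multiset.toFinset_card_le _).trans ((Polynomial.card_roots' _).trans_eq
        (FiniteField.X_pow_card_sub_X_natDegree_eq (𝓞 E ⧸ Q.under (𝓞 E)) hq1)))
    rw [Multiset.mem_toFinset, Polynomial.mem_roots hX]
    simp [hroot y]
  refine le_antisymm hle ?_
  rw [hpow]
  exact Nat.le_self_pow (Ideal.inertiaDeg'_ne_zero _ _) q

/-- The base ring enters the Frobenius condition only through the size of the residue field below
`Q`. -/
theorem isArithFrobAt_fixingSubgroupEquiv_iff (Q : Ideal (𝓞 L)) (h : E.fixingSubgroup)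
    (hN : Ideal.absNorm (Q.under (𝓞 E)) = Ideal.absNorm (Q.under (𝓞 K))) :
    IsArithFrobAt (𝓞 E) (E.fixingSubgroupEquiv h) Q ↔ IsArithFrobAt (𝓞 K) (h : Gal(L/K)) Q := by
  refine forall_congr' fun x => ?_
  rw [natCard_quotient_eq_absNorm, natCard_quotient_eq_absNorm, hN]
  rfl

variable [IsGalois K L]

open scoped Classical in
/-- The value at `v` of the frobenian function attached to the induced class function is the sum
of the values of `ψ` at the primes of degree one of `E` above `v`. -/
theorem sum_frobenian_eq_frobenian_induced
    {S : Set (HeightOneSpectrum (𝓞 K))} {T : Set (HeightOneSpectrum (𝓞 E))}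
    {φ : Gal(L/E) → ℝ} {ψ : {w // w ∉ T} → ℝ} {ψ' : {v // v ∉ S} → ℝ}
    (hψ : IsFrobenianWith E L T φ ψ) (hψ' : IsFrobenianWith K L S (galoisInduced E φ) ψ')
    (v : {v // v ∉ S}) (W : Finset (HeightOneSpectrum (𝓞 E)))
    (hW : ∀ w, w ∈ W ↔
      w.under (𝓞 K) = v.1 ∧ Ideal.absNorm w.asIdeal = Ideal.absNorm v.1.asIdeal)
    (hT : ∀ w ∈ W, w ∉ T) :
    ∑ w ∈ W, (if h : w ∉ T then ψ ⟨w, h⟩ else 0) = ψ' v := by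
  have hfaith : FaithfulSMul Gal(L/K) (𝓞 L) := IsGaloisGroup.faithful (𝓞 K)
  obtain ⟨Q, hQmax, hQ⟩ := Ideal.exists_maximal_ideal_liesOver_of_isIntegral (S := 𝓞 L) v.1.asIdeal
  have hunder (g : Gal(L/K)) : (g • Q).under (𝓞 K) = v.1.asIdeal := by
    rw [Ideal.under_smul, ← Q.over_def v.1.asIdeal]
  have hover (g : Gal(L/K)) : (g • Q).LiesOver v.1.asIdeal := ⟨(hunder g).symm⟩
  have hne (g : Gal(L/K)) : g • Q ≠ ⊥ := Ideal.ne_bot_of_liesOver_of_ne_bot v.1.ne_bot _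
  have hunram (g : Gal(L/K)) : Algebra.IsUnramifiedAt (𝓞 K) (g • Q) :=
    hψ'.unramified v.1 v.2 (g • Q)
  have hfin (g : Gal(L/K)) : Finite (𝓞 L ⧸ g • Q) := Ideal.finiteQuotientOfFreeOfNeBot _ (hne g)
  have : Finite (𝓞 L ⧸ Q) := by simpa using hfin 1
  obtain ⟨σ, hσ⟩ := IsArithFrobAt.exists_of_isInvariant (𝓞 K) Gal(L/K) Q
  rw [hψ'.eq_frob v Q σ hσ]
  have hconj (g : Gal(L/K)) : IsArithFrobAt (𝓞 K) (g⁻¹ * σ * g) (g⁻¹ • Q) := by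
    simpa using hσ.conj g⁻¹
  let P (q : Gal(L/K) ⧸ E.fixingSubgroup) : HeightOneSpectrum (𝓞 E) :=
    ⟨(q.out⁻¹ • Q).under (𝓞 E), inferInstance, mt Ideal.eq_bot_of_comap_eq_bot (hne _)⟩
  have hPv (q) : (P q).under (𝓞 K) = v.1 := by
    apply HeightOneSpectrum.ext
    simp only [P, HeightOneSpectrum.under_asIdeal, Ideal.under_under, hunder]
  unfold galoisInduced inducedClassFunction
  let : Fintype (Gal(L/K) ⧸ E.fixingSubgroup) := Fintype.ofFinite _
  symm
  rw [← Finset.sum_filter_of_ne (p := fun q : Gal(L/K) ⧸ E.fixingSubgroup =>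
    q.out⁻¹ * σ * q.out ∈ E.fixingSubgroup)]
  swap
  · intro q _ hq
    by_contra hn
    exact hq (dif_neg hn)
  refine Finset.sum_bij (fun q _ => P q) ?_ ?_ ?_ ?_
  · intro q hq
    rw [hW]
    refine ⟨hPv q, ?_⟩
    have := absNorm_under_eq_of_isArithFrobAt E _ (hne _) (Finset.mem_filter.mp hq).2
      (hconj q.out)
    rwa [hunder] at this
  -- Injectivity: primes of `L` over the same prime of `E` differ by some `h ∈ H`, so `q.out⁻¹ *
  -- q'.out * h` stabilizes `q.out⁻¹ • Q`. It is therefore a power of the Frobenius there, which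
  -- lies in `H`.
  · intro q hq q' hq' hPP
    have hH := (Finset.mem_filter.mp hq).2
    have hPP' : (q.out⁻¹ • Q).under (𝓞 E) = (q'.out⁻¹ • Q).under (𝓞 E) :=
      congrArg HeightOneSpectrum.asIdeal hPP
    obtain ⟨τ, hτ⟩ := Algebra.IsInvariant.exists_smul_of_under_eq (𝓞 E) (𝓞 L) Gal(L/E) _ _ hPP'
    obtain ⟨h, rfl⟩ := E.fixingSubgroupEquiv.surjective τ
    rw [fixingSubgroupEquiv_smul_ideal, smul_smul] at hτ
    have hd : q.out⁻¹ * q'.out * h ∈ MulAction.stabilizer Gal(L/K) (q.out⁻¹ • Q) := by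
      rw [MulAction.mem_stabilizer_iff, smul_smul, mul_assoc, mul_assoc, mul_smul, mul_smul, ← hτ,
        smul_inv_smul]
    obtain ⟨n, hn⟩ := (hconj q.out).exists_pow_eq_of_isUnramifiedAt hd
    have hmem : q.out⁻¹ * q'.out ∈ E.fixingSubgroup := by
      rw [← E.fixingSubgroup.mul_mem_cancel_right h.2, ← hn]
      exact pow_mem hH n
    rw [← QuotientGroup.eq] at hmem
    simpa using hmem
  · intro w hw
    obtain ⟨hwv, hwN⟩ := (hW w).mp hw
    have hwv' : w.asIdeal.under (𝓞 K) = v.1.asIdeal := congrArg HeightOneSpectrum.asIdeal hwv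
    obtain ⟨Q', hQ'max, hQ'⟩ := Ideal.exists_maximal_ideal_liesOver_of_isIntegral (S := 𝓞 L)
      w.asIdeal
    have hQ'K : Q.under (𝓞 K) = Q'.under (𝓞 K) := by
      rw [← Ideal.under_under (B := 𝓞 E) Q', ← Q'.over_def w.asIdeal, hwv', ← Q.over_def v.1.asIdeal]
    obtain ⟨g, rfl⟩ := Algebra.IsInvariant.exists_smul_of_under_eq (𝓞 K) (𝓞 L) Gal(L/K) _ _ hQ'K
    obtain ⟨τ, hτ⟩ := IsArithFrobAt.exists_of_isInvariant (𝓞 E) Gal(L/E) (g • Q)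
    obtain ⟨h, rfl⟩ := E.fixingSubgroupEquiv.surjective τ
    rw [isArithFrobAt_fixingSubgroupEquiv_iff E _ _ (by
      rw [← (g • Q).over_def w.asIdeal, hunder, hwN])] at hτ
    -- Surjectivity: equal norms make the Frobenius over `E` one over `K`, so uniqueness puts `g * σ
    -- * g⁻¹` in `H`, and the coset of `g⁻¹` is the preimage.
    have hgσ : g * σ * g⁻¹ = h := (hσ.conj g).eq_of_isUnramifiedAt hτ
    -- The chosen representative is `g⁻¹ * k` with `k ∈ H`; this conjugates within `H` and does not
    -- change the prime of `E`.
    obtain ⟨k, hk⟩ := QuotientGroup.mk_out_eq_mul E.fixingSubgroup g⁻¹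
    refine ⟨(g⁻¹ : Gal(L/K)), ?_, ?_⟩
    · rw [Finset.mem_filter, hk]
      refine ⟨Finset.mem_univ _, ?_⟩
      have : (g⁻¹ * (k : Gal(L/K)))⁻¹ * σ * (g⁻¹ * k) =
          ((k⁻¹ * h * k : E.fixingSubgroup) : Gal(L/K)) := by
        simp [← hgσ, mul_assoc]
      rw [this]
      exact SetLike.coe_mem _
    · apply HeightOneSpectrum.ext
      simp only [P, hk, mul_inv_rev, inv_inv, mul_smul]
      rw [← InvMemClass.coe_inv, ← fixingSubgroupEquiv_smul_ideal, Ideal.under_smul,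
        ← (g • Q).over_def w.asIdeal]
  · intro q hq
    have hH := (Finset.mem_filter.mp hq).2
    have hN := absNorm_under_eq_of_isArithFrobAt E _ (hne _) hH (hconj q.out)
    have hPT : P q ∉ T := hT _ ((hW _).mpr ⟨hPv q, by rwa [hunder] at hN⟩)
    rw [dif_pos hPT, extendByZero, dif_pos hH]
    have hlies : (q.out⁻¹ • Q).LiesOver (P q).asIdeal := ⟨rfl⟩
    refine (hψ.eq_frob ⟨P q, hPT⟩ (q.out⁻¹ • Q) _ ?_).symm
    rw [isArithFrobAt_fixingSubgroupEquiv_iff E _ _ hN]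
    exact hconj q.out

end

end

/-! ### Comparison of the two prime sums -/

theorem finite_heightOneSpectrum_norm_le (F : Type*) [Field F] [NumberField F] (x : ℝ) :
    {v : HeightOneSpectrum (𝓞 F) | (Ideal.absNorm v.asIdeal : ℝ) ≤ x}.Finite := by
  have h := (finite_primes_norm_le F ∅ x).image Subtype.val
  refine h.subset fun v hv => ⟨⟨v, Set.notMem_empty v⟩, hv, rfl⟩

open scoped Classical in
theorem primeSum_eq_sum_extend (F : Type*) [Field F] [NumberField F]
    (S : Set (HeightOneSpectrum (𝓞 F))) (ψ : {v // v ∉ S} → ℝ) (x : ℝ) :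
    primeSum F S ψ x = ∑ v ∈ (finite_heightOneSpectrum_norm_le F x).toFinset,
      if h : v ∉ S then ψ ⟨v, h⟩ else 0 := by
  symm
  refine Finset.sum_bij_ne_zero (fun v _ hv => ⟨v, fun hS => hv (dif_neg (not_not.mpr hS))⟩)
    ?_ ?_ ?_ ?_
  · intro v hv _
    simpa using hv
  · intro v _ _ w _ _ h
    exact congrArg Subtype.val h
  · intro v hv hne
    refine ⟨v.1, by simpa using hv, ?_, rfl⟩
    rwa [dif_pos v.2]
  · intro v _ hv
    rw [dif_pos]

theorem IsFrobenianWith.abs_le {K L : Type*} [Field K] [NumberField K] [Field L] [NumberField L]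
    [Algebra K L] [IsGalois K L] {S : Set (HeightOneSpectrum (𝓞 K))} {φ : Gal(L/K) → ℝ}
    {ψ : {v // v ∉ S} → ℝ} (hψ : IsFrobenianWith K L S φ ψ) (v : {v // v ∉ S}) :
    |ψ v| ≤ ∑ σ, |φ σ| := by
  obtain ⟨Q, hQmax, hQ⟩ := Ideal.exists_maximal_ideal_liesOver_of_isIntegral (S := 𝓞 L) v.1.asIdeal
  have hfin : Finite (𝓞 L ⧸ Q) :=
    Ideal.finiteQuotientOfFreeOfNeBot _ (Ideal.ne_bot_of_liesOver_of_ne_bot v.1.ne_bot _)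
  obtain ⟨σ, hσ⟩ := IsArithFrobAt.exists_of_isInvariant (𝓞 K) Gal(L/K) Q
  rw [hψ.eq_frob v Q σ hσ]
  exact Finset.single_le_sum (f := fun σ => |φ σ|) (fun _ _ => abs_nonneg _) (Finset.mem_univ σ)

theorem absNorm_eq_pow_absNorm_under {A B : Type*} [CommRing A] [CommRing B] [IsDedekindDomain A]
    [IsDedekindDomain B] [Module.Free ℤ A] [Module.Free ℤ B] [Algebra A B] [Module.Finite A B]
    [Algebra.IsIntegral A B] (w : HeightOneSpectrum B) :
    ∃ n, n ≠ 0 ∧ Ideal.absNorm w.asIdeal = Ideal.absNorm (w.under A).asIdeal ^ n := by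
  have hmax : (w.under A).asIdeal.IsMaximal := (w.under A).isMaximal
  have hlies : w.asIdeal.LiesOver (w.under A).asIdeal := ⟨rfl⟩
  exact ⟨_, Ideal.inertiaDeg'_ne_zero (w.under A).asIdeal w.asIdeal,
    Ideal.absNorm_eq_pow_inertiaDeg'_of_liesOver _ _ (w.under A).isPrime (w.under A).ne_bot⟩

theorem abs_primeSum_sub_primeSum_le {K L : Type*} [Field K] [NumberField K] [Field L]
    [NumberField L] [Algebra K L] [IsGalois K L] (E : IntermediateField K L)
    {S : Set (HeightOneSpectrum (𝓞 K))} {T : Set (HeightOneSpectrum (𝓞 E))}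
    {φ : Gal(L/E) → ℝ} {ψ : {w // w ∉ T} → ℝ} {ψ' : {v // v ∉ S} → ℝ}
    (hψ : IsFrobenianWith E L T φ ψ) (hψ' : IsFrobenianWith K L S (galoisInduced E φ) ψ') :
    ∃ C, ∀ x, |primeSum E T ψ x - primeSum K S ψ' x| ≤ C * (√x + 1) := by
  classical
  let f (w : HeightOneSpectrum (𝓞 E)) : ℝ := if h : w ∉ T then ψ ⟨w, h⟩ else 0
  let f' (v : HeightOneSpectrum (𝓞 K)) : ℝ := if h : v ∉ S then ψ' ⟨v, h⟩ else 0
  let N (w : HeightOneSpectrum (𝓞 E)) : ℕ := Ideal.absNorm w.asIdeal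
  let N' (v : HeightOneSpectrum (𝓞 K)) : ℕ := Ideal.absNorm v.asIdeal
  let u (w : HeightOneSpectrum (𝓞 E)) : HeightOneSpectrum (𝓞 K) := w.under (𝓞 K)
  let W (x : ℝ) := (finite_heightOneSpectrum_norm_le E x).toFinset
  let V (x : ℝ) := (finite_heightOneSpectrum_norm_le K x).toFinset
  have hmemW {x w} : w ∈ W x ↔ (N w : ℝ) ≤ x := by simp [W, N]
  have hmemV {x v} : v ∈ V x ↔ (N' v : ℝ) ≤ x := by simp [V, N']
  -- Besides `S`, the primes below `T` are excluded, so that outside `B` every prime of `E` above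
  -- `v` lies in the domain of `ψ`.
  let B : Finset (HeightOneSpectrum (𝓞 K)) := (hψ'.finite.union (hψ.finite.image u)).toFinset
  have hB {v} : v ∉ B ↔ v ∉ S ∧ ∀ w ∈ T, u w ≠ v := by simp [B]
  set M := ∑ σ, |φ σ|
  have hM0 : 0 ≤ M := Finset.sum_nonneg fun _ _ => abs_nonneg _
  have hf (w) : |f w| ≤ M := by
    by_cases h : w ∉ T
    · simpa only [f, dif_pos h] using hψ.abs_le ⟨w, h⟩
    · simpa only [f, dif_neg h, abs_zero] using hM0
  -- A bound for all norms in `B`: primes of `D` above `B` then lie in `W b`, so their contribution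
  -- is bounded independently of `x`.
  set b : ℝ := ∑ v ∈ B, (N' v : ℝ)
  have hNb {v} (hv : v ∈ B) : (N' v : ℝ) ≤ b :=
    Finset.single_le_sum (f := fun v => (N' v : ℝ)) (fun _ _ => Nat.cast_nonneg _) hv
  set C₁ := ∑ w ∈ W b, |f w|
  set C₂ := ∑ v ∈ B, |f' v|
  refine ⟨C₁ + C₂ + M * Module.finrank ℚ E, fun x => ?_⟩
  let D := (W x).filter fun w => N w = N' (u w)
  let R := (W x).filter fun w => N w ≠ N' (u w)
  have hE : primeSum E T ψ x = ∑ w ∈ D with u w ∉ B, f w + ∑ w ∈ D with u w ∈ B, f w +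
      ∑ w ∈ R, f w := by
    rw [add_comm (∑ w ∈ D with u w ∉ B, f w), Finset.sum_filter_add_sum_filter_not,
      primeSum_eq_sum_extend]
    exact (Finset.sum_filter_add_sum_filter_not (W x) (fun w => N w = N' (u w)) f).symm
  -- Grouping the primes of `D` by the prime below them yields the same main term as in `hE`.
  have hK : primeSum K S ψ' x = ∑ w ∈ D with u w ∉ B, f w + ∑ v ∈ V x with v ∈ B, f' v := by
    rw [primeSum_eq_sum_extend, ← Finset.sum_filter_add_sum_filter_not (V x) (fun v => v ∈ B),
      add_comm]
    congr 1
    rw [← Finset.sum_fiberwise_of_maps_to (s := D.filter fun w => u w ∉ B)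
      (t := (V x).filter fun v => v ∉ B) (g := u)]
    · refine Finset.sum_congr rfl fun v hv => ?_
      obtain ⟨hvx, hvB⟩ := Finset.mem_filter.mp hv
      rw [hmemV] at hvx
      rw [dif_pos (hB.mp hvB).1]
      symm
      refine sum_frobenian_eq_frobenian_induced E hψ hψ' ⟨v, (hB.mp hvB).1⟩ _ (fun w => ?_) ?_
      · simp only [D, Finset.mem_filter, hmemW]
        constructor
        · rintro ⟨⟨⟨-, h1⟩, -⟩, rfl⟩
          exact ⟨rfl, h1⟩
        · rintro ⟨rfl, h1⟩
          have h2 : N w = N' (u w) := h1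
          exact ⟨⟨⟨by rwa [h2], h2⟩, hvB⟩, rfl⟩
      · intro w hw hwT
        exact (hB.mp hvB).2 w hwT (Finset.mem_filter.mp hw).2
    · intro w hw
      simp only [D, Finset.mem_filter, hmemW] at hw
      rw [Finset.mem_filter, hmemV, ← hw.1.2]
      exact ⟨hw.1.1, hw.2⟩
  have h1 : |∑ w ∈ D with u w ∈ B, f w| ≤ C₁ := by
    refine (Finset.abs_sum_le_sum_abs _ _).trans
      (Finset.sum_le_sum_of_subset_of_nonneg (fun w hw => ?_) fun _ _ _ => abs_nonneg _)
    simp only [D, Finset.mem_filter] at hw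
    rw [hmemW, hw.1.2]
    exact hNb hw.2
  have h2 : |∑ v ∈ V x with v ∈ B, f' v| ≤ C₂ :=
    (Finset.abs_sum_le_sum_abs _ _).trans (Finset.sum_le_sum_of_subset_of_nonneg
      (fun v hv => (Finset.mem_filter.mp hv).2) fun _ _ _ => abs_nonneg _)
  have h3 : |∑ w ∈ R, f w| ≤ M * Module.finrank ℚ E * (√x + 1) := by
    have hR : (R.card : ℝ) ≤ Module.finrank ℚ E * (√x + 1) := by
      refine card_primes_norm_le_not_prime E R fun w hw => ?_
      obtain ⟨hwx, hne⟩ := Finset.mem_filter.mp hw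
      refine ⟨hmemW.mp hwx, fun hp => ?_⟩
      -- The norm of `w` is a power of the norm below; were it prime, the exponent would be 1 and
      -- the norms equal, contrary to `w ∈ R`.
      obtain ⟨n, hn, hpow⟩ := absNorm_eq_pow_absNorm_under (A := 𝓞 K) w
      have hn1 : n = 1 := by
        rw [hpow] at hp
        exact Nat.Prime.eq_one_of_pow hp
      rw [hn1, pow_one] at hpow
      exact hne hpow
    calc |∑ w ∈ R, f w| ≤ ∑ w ∈ R, |f w| := Finset.abs_sum_le_sum_abs _ _
      _ ≤ ∑ w ∈ R, M := Finset.sum_le_sum fun w _ => hf w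
      _ = M * R.card := by rw [Finset.sum_const, nsmul_eq_mul, mul_comm]
      _ ≤ M * (Module.finrank ℚ E * (√x + 1)) := by gcongr
      _ = _ := by ring
  have hs : 1 ≤ √x + 1 := le_add_of_nonneg_left (Real.sqrt_nonneg x)
  have hC : 0 ≤ C₁ + C₂ := add_nonneg ((abs_nonneg _).trans h1) ((abs_nonneg _).trans h2)
  have h4 : C₁ + C₂ ≤ (C₁ + C₂) * (√x + 1) := le_mul_of_one_le_right hC hs
  rw [hE, hK, add_mul]
  rw [abs_le] at h1 h2 h3 ⊢
  constructor <;> linarith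

theorem mainTheorem1 (K L : Type*) [Field K] [NumberField K] [Field L] [NumberField L]
    [Algebra K L] [IsGalois K L] (E : IntermediateField K L)
    (S : Set (HeightOneSpectrum (𝓞 K))) (T : Set (HeightOneSpectrum (𝓞 E)))
    (φ : Gal(L/E) → ℝ) (ψ : {w // w ∉ T} → ℝ) (ψ' : {v // v ∉ S} → ℝ)
    (hψ : IsFrobenianWith E L T φ ψ)
    (hψ' : IsFrobenianWith K L S (galoisInduced E φ) ψ') :
    (∀ ℓ : ℝ, HasPrimeMean E T ψ ℓ ↔ HasPrimeMean K S ψ' ℓ) ∧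
      Tendsto (fun x : ℝ => primeSum E T ψ x / logIntegral x - primeSum K S ψ' x / logIntegral x)
        atTop (𝓝 0) := by
  obtain ⟨C, hC⟩ := abs_primeSum_sub_primeSum_le E hψ hψ'
  have h := tendsto_div_logIntegral_of_abs_le hC
  simp only [sub_div] at h
  refine ⟨fun ℓ => ⟨fun hE => ?_, fun hK => ?_⟩, h⟩
  · simpa [HasPrimeMean] using hE.sub h
  · simpa [HasPrimeMean] using h.add hK
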